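/- Let $k=\mathbb{F}_q$ be a finite field of characteristic $p$, let $W\subseteq\mathbb{F}_q$ be an $\mathbb{F}_p$-subspace of dimension $r$, and put $L(T)=\prod_{w\in W}(T-w)\in\mathbb{F}_q[T]$. Let $u(x)\in\mathbb{F}_q[x]$ be a polynomial of degree $d$ coprime to $p$, let $F=\mathbb{F}_q(x)$ be the rational function field, and let $E=F(y)$ be an extension field of $F$ with $L(y)=u(x)$. Then the following hold. (i) $E/F$ is Galois of degree $[E:F]=p^r$, and $\mathrm{Gal}(E/F)\cong(\mathbb{Z}/p\mathbb{Z})^r$; more precisely, there is a group isomorphism $\mathrm{Gal}(E/F)\to W$, $\sigma\mapsto w_\sigma$, such that $\sigma(y)=y+w_\sigma$ for all $\sigma$. (ii) The element $x$ has a unique pole $Q_\infty$ among the places of $F$, and $Q_\infty$ is totally ramified in $E/F$ (there is exactly one place of $E$ above it, with ramification index $[E:F]$). If $P_\infty$ is the unique place of $E$ above $Q_\infty$, then the normalized discrete valuations of $x$ and $y$ at $P_\infty$ are $\nu_{P_\infty}(x)=-p^r$ and $\nu_{P_\infty}(y)=-d$. (iii) For every place $Q\neq Q_\infty$ of $F$,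 $\{1,y,\dots,y^{p^r-1}\}$ is an integral basis of $E/F$ at $Q$; that is, it is an $F$-basis of $E$, and the integral closure in $E$ of the valuation ring $\mathcal{O}_Q$ is $\bigoplus_{i=0}^{p^r-1}\mathcal{O}_Q\,y^i$. (iv) If $Q$ is a rational place of $F$ such that the equation $L(T)=u(Q)$ has a solution $T\in\mathbb{F}_q$, where $u(Q)$ is the residue class of $u(x)$ at $Q$ (in particular $u(x)$ is regular at $Q$), then $Q$ splits completely in $E/F$, i.e. there are exactly $[E:F]$ places of $E$ above $Q$. -/

import Mathlib

open Polynomial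

noncomputable section

/-- A place of a function field `K` over the constant field `k`, given by its valuation ring:
a proper valuation ring of `K` that contains `k`. The place itself is the maximal ideal of
that ring and is determined by the ring. -/
structure FFPlace (k K : Type*) [Field k] [Field K] [Algebra k K] where
  /-- the valuation ring of the place -/
  ring : ValuationSubring K
  algebraMap_mem : ∀ a : k, algebraMap k K a ∈ ring
  ne_top : ring ≠ ⊤

namespace FFPlace

section Basic

variable {k K : Type*} [Field k] [Field K] [Algebra k K]

/-- The valuation ring of a place is a `k`-algebra; so is then its residue class field. -/
instance algebraRing (P : FFPlace k K) : Algebra k P.ring :=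
  ((algebraMap k K).codRestrict P.ring.toSubring P.algebraMap_mem).toAlgebra

/-- The residue class field of a place. -/
abbrev ResidueField (P : FFPlace k K) : Type _ := IsLocalRing.ResidueField P.ring

/-- The degree of a place: the degree of its residue class field over `k`. -/
def degree (P : FFPlace k K) : ℕ := Module.finrank k P.ResidueField

/-- A place is rational if it has degree one. -/
def IsRational (P : FFPlace k K) : Prop := P.degree = 1

/-- `f` has a pole at `P`. -/
def IsPole (P : FFPlace k K) (f : K) : Prop := f ∉ P.ring

/-- `f(P) = c` for a constant `c`: the function `f` is regular at `P`, and its residue class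
is (the image of) `c`. -/
def HasValue (P : FFPlace k K) (f : K) (c : k) : Prop :=
  ∃ h : f ∈ P.ring, IsLocalRing.residue P.ring ⟨f, h⟩ = algebraMap k P.ResidueField c

/-- `t` is a prime element (local parameter) at `P`: a generator of the maximal ideal. -/
def IsPrimeElement (P : FFPlace k K) (t : P.ring) : Prop :=
  IsLocalRing.maximalIdeal P.ring = Ideal.span {t}

open Classical in
/-- The normalized discrete valuation of a place: `ν_P(0) = ∞`, and `ν_P(t ^ n * u) = n` for a
prime element `t` and a unit `u` of the valuation ring. (The valuation ring of a place of a
function field is a discrete valuation ring, so that every `f ≠ 0` has such a form, with only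
one `n`.) -/
def ord (P : FFPlace k K) (f : K) : WithTop ℤ :=
  if f = 0 then ⊤
  else if h : ∃ n : ℤ, ∃ t : P.ring, ∃ u : P.ringˣ,
      P.IsPrimeElement t ∧ f = (t : K) ^ n * ((u : P.ring) : K) then
    ((h.choose : ℤ) : WithTop ℤ)
  else 0

end Basic

section Extension

variable {k F E : Type*} [Field k] [Field F] [Field E] [Algebra k F] [Algebra k E] [Algebra F E]

/-- The place `P` of `E` lies above the place `Q` of `F`: `O_P ∩ F = O_Q`. -/
def LiesAbove (P : FFPlace k E) (Q : FFPlace k F) : Prop :=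
  P.ring.comap (algebraMap F E) = Q.ring

/-- `e` is the ramification index of `P` over `Q`: `ν_P(f) = e · ν_Q(f)` for all `f ∈ Fˣ`. -/
def HasRamificationIndex (P : FFPlace k E) (Q : FFPlace k F) (e : ℕ) : Prop :=
  ∀ f : F, f ≠ 0 → P.ord (algebraMap F E f) = e • Q.ord f

variable (E) in
/-- `Q` is totally ramified in `E / F`: there is exactly one place of `E` above `Q`, and its
ramification index is `[E : F]`. -/
def TotallyRamified (Q : FFPlace k F) : Prop :=
  ∃ P : FFPlace k E, (∀ P' : FFPlace k E, P'.LiesAbove Q ↔ P' = P) ∧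
    P.HasRamificationIndex Q (Module.finrank F E)

variable (E) in
/-- `Q` splits completely in `E / F`: there are exactly `[E : F]` places of `E` above `Q`. -/
def SplitsCompletely (Q : FFPlace k F) : Prop :=
  {P : FFPlace k E | P.LiesAbove Q}.Finite ∧
    {P : FFPlace k E | P.LiesAbove Q}.ncard = Module.finrank F E

/-- `b` is an integral basis of `E / F` at `Q`: a basis of `E` over `F` such that the integral
closure of `O_Q` in `E` is the `O_Q`-module spanned by `b`. -/
def IsIntegralBasisAt (Q : FFPlace k F) {ι : Type*} (b : ι → E) : Prop :=
  LinearIndependent F b ∧ Submodule.span F (Set.range b) = ⊤ ∧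
    Submodule.span Q.ring (Set.range b) = Subalgebra.toSubmodule (integralClosure Q.ring E)

end Extension

end FFPlace

/-- The polynomial `∏_{w ∈ W} (T - w)` of a finite subspace `W` of a field over `𝔽_p`. -/
def subspacePoly {p : ℕ} {k : Type*} [Field k] [Module (ZMod p) k]
    (W : Submodule (ZMod p) k) : k[X] :=
  ∏ᶠ w : W, (X - C (w : k))

end

/-! Write `N = |W| = p ^ r`. The polynomial `L` is invariant under translation by `W`, so `L(T) -
L(a) = ∏ (T - a - w)` and `L'` is a nonzero constant (`map_subspacePoly_sub`,
`derivative_subspacePoly`). Hence the roots of `L(T) = u` are the `y + w`, `E/F` is Galois, and an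
automorphism is determined by its translation of `y`.

At a pole of `x`, `L(y) = u` forces `v(y) ^ N = v(x) ^ d`. As `N` and `d` are coprime, the terms
`c_i y ^ i` with `i < N` have pairwise distinct values (`exists_valuation_sum_eq`). This gives at
once the degree `N`, the uniqueness of the place above infinity and its total ramification.

At any other place `u` is regular and the discriminant of the powers of `y` is a nonzero constant,
so they form an integral basis (`mem_adjoin_of_isIntegral`). If moreover `u(Q) = L(α)`, a place
above `Q` is determined by the residue `α + w` of `y`, and the Galois group permutes these residues
transitively, so there are `N` places. -/

noncomputable section

namespace FFPlace

/-! ### Prime elements and the normalized valuation. -/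

section Basic

variable {k K : Type*} [Field k] [Field K] [Algebra k K]

@[ext]
theorem ext {P P' : FFPlace k K} (h : P.ring = P'.ring) : P = P' := by
  cases P; cases P'; congr

/-- The valuation of a place is trivial on the constants. -/
theorem valuation_isTrivialOn (P : FFPlace k K) : P.ring.valuation.IsTrivialOn k := by
  refine ⟨fun a ha => le_antisymm ?_ ?_⟩
  · exact (P.ring.valuation_le_one_iff _).2 (P.algebraMap_mem a)
  · have h := (P.ring.valuation_le_one_iff _).2 (P.algebraMap_mem a⁻¹)
    rw [map_inv₀, map_inv₀] at h
    exact (inv_le_one₀ (zero_lt_iff.2 (by simpa using ha))).1 h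

/-- Turns ideal generation into an order condition: the value of a prime element is the largest one
below 1. Values are written multiplicatively, with poles above 1. -/
theorem isPrimeElement_iff (P : FFPlace k K) (t : P.ring) :
    P.IsPrimeElement t ↔
      ∀ z : K, P.ring.valuation z < 1 ↔ P.ring.valuation z ≤ P.ring.valuation (t : K) := by
  have key : ∀ z : P.ring, z ∈ Ideal.span {t} ↔
      P.ring.valuation (z : K) ≤ P.ring.valuation (t : K) := by
    intro z
    rw [Ideal.mem_span_singleton, ValuationSubring.valuation_le_iff]
    constructor
    · rintro ⟨c, rfl⟩
      exact ⟨c, by simp [mul_comm]⟩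
    · rintro ⟨c, hc⟩
      exact ⟨c, Subtype.ext (by simp [← hc, mul_comm])⟩
  unfold IsPrimeElement
  constructor
  · intro h z
    by_cases hz : z ∈ P.ring
    · rw [← key ⟨z, hz⟩, ← h, ValuationSubring.valuation_lt_one_iff]
    · have h1 : 1 < P.ring.valuation z := by
        rwa [← not_le, ValuationSubring.valuation_le_one_iff]
      refine iff_of_false h1.not_gt fun h2 => ?_
      exact absurd (h2.trans (P.ring.valuation_le_one t)) h1.not_ge
  · intro h
    ext z
    rw [key, ValuationSubring.valuation_lt_one_iff]
    exact h z

theorem IsPrimeElement.valuation_lt_one {P : FFPlace k K} {t : P.ring} (ht : P.IsPrimeElement t) :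
    P.ring.valuation (t : K) < 1 :=
  ((P.isPrimeElement_iff t).1 ht _).2 le_rfl

/-- If `t = 0`, the maximal ideal is zero and the valuation ring is all of `K`, which `ne_top`
excludes. -/
theorem IsPrimeElement.valuation_pos {P : FFPlace k K} {t : P.ring} (ht : P.IsPrimeElement t) :
    0 < P.ring.valuation (t : K) := by
  rw [zero_lt_iff]
  intro h0
  apply P.ne_top
  rw [eq_top_iff]
  intro z _
  by_contra hz
  have hz0 : z ≠ 0 := by rintro rfl; exact hz P.ring.zero_mem
  have h1 : 1 < P.ring.valuation z := by
    rwa [← not_le, ValuationSubring.valuation_le_one_iff]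
  have h2 := ((P.isPrimeElement_iff t).1 ht z⁻¹).1 (by
    rw [map_inv₀]; exact inv_lt_one_of_one_lt₀ h1)
  rw [h0, le_zero_iff, map_eq_zero, inv_eq_zero] at h2
  exact hz0 h2

/-- The normalized valuation is computed by any prime element. -/
theorem ord_eq_of_valuation_eq {P : FFPlace k K} {t : P.ring} (ht : P.IsPrimeElement t) {f : K}
    {n : ℤ} (hf : P.ring.valuation f = P.ring.valuation (t : K) ^ n) : P.ord f = n := by
  have ht0 := ht.valuation_pos
  have ht1 := ht.valuation_lt_one
  have hf0 : f ≠ 0 := by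
    rintro rfl
    rw [map_zero] at hf
    exact (zpow_pos ht0 n).ne hf
  have htK : (t : K) ≠ 0 := fun h => by simp [h] at ht0
  have hex : ∃ n : ℤ, ∃ t : P.ring, ∃ u : P.ringˣ,
      P.IsPrimeElement t ∧ f = (t : K) ^ n * ((u : P.ring) : K) := by
    have hu : P.ring.valuation (f / (t : K) ^ n) = 1 := by
      rw [map_div₀, map_zpow₀, hf, div_self (zpow_pos ht0 n).ne']
    let x : P.ring := ⟨f / (t : K) ^ n, (P.ring.valuation_le_one_iff _).1 hu.le⟩
    have hx : IsUnit x := (P.ring.valuation_eq_one_iff x).2 hu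
    refine ⟨n, t, hx.unit, ht, ?_⟩
    simp only [IsUnit.unit_spec, x]
    rw [mul_div_cancel₀]
    exact zpow_ne_zero _ htK
  rw [ord, if_neg hf0, dif_pos hex]
  obtain ⟨t', u, ht', h'⟩ := hex.choose_spec
  generalize hex.choose = m at h'
  have hv : P.ring.valuation f = P.ring.valuation (t' : K) ^ m := by
    rw [h', map_mul, map_zpow₀, P.ring.valuation_unit u, mul_one]
  -- The representation chosen in `ord` may use another prime element, but all prime elements have
  -- the same value.
  have htt : P.ring.valuation (t' : K) = P.ring.valuation (t : K) :=
    le_antisymm (((P.isPrimeElement_iff t).1 ht _).1 ht'.valuation_lt_one)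
      (((P.isPrimeElement_iff t').1 ht' _).1 ht1)
  rw [hf, htt] at hv
  have := zpow_right_injective₀ ht0 ht1.ne hv
  rw [this]

end Basic

/-! ### Places above a given place. -/

section Extension

variable {k F E : Type*} [Field k] [Field F] [Field E] [Algebra k F] [Algebra k E] [Algebra F E]

theorem LiesAbove.algebraMap_mem_iff {P : FFPlace k E} {Q : FFPlace k F} (h : P.LiesAbove Q)
    (f : F) : algebraMap F E f ∈ P.ring ↔ f ∈ Q.ring := by
  rw [← (h : _ = _), ValuationSubring.mem_comap]

theorem LiesAbove.valuation_lt_one_iff {P : FFPlace k E} {Q : FFPlace k F} (h : P.LiesAbove Q)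
    (f : F) : P.ring.valuation (algebraMap F E f) < 1 ↔ Q.ring.valuation f < 1 := by
  rcases eq_or_ne f 0 with rfl | hf
  · simp
  have h1 := h.algebraMap_mem_iff f⁻¹
  rw [← ValuationSubring.valuation_le_one_iff, ← ValuationSubring.valuation_le_one_iff,
    map_inv₀, map_inv₀, map_inv₀, inv_le_one₀ (zero_lt_iff.2 (by simpa using hf)),
    inv_le_one₀ (zero_lt_iff.2 (by simpa using hf))] at h1
  rw [← not_le, h1, not_le]

/-- Every place extends to a field extension. -/
theorem exists_liesAbove [IsScalarTower k F E] (Q : FFPlace k F) :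
    ∃ P : FFPlace k E, P.LiesAbove Q := by
  -- A valuation ring of `E` dominating `O_Q`. Locality of the map makes its trace on `F` no larger
  -- than `O_Q`: if `f ∉ O_Q` were in `A`, the nonunit `f⁻¹` of `O_Q` would become a unit.
  obtain ⟨A, h, hloc⟩ := IsLocalRing.exists_factor_valuationRing
    ((algebraMap F E).comp Q.ring.subtype)
  have hA : A.comap (algebraMap F E) = Q.ring := by
    ext f
    rw [ValuationSubring.mem_comap]
    refine ⟨fun hf => ?_, fun hf => h ⟨f, hf⟩⟩
    by_contra hfQ
    have hf0 : f ≠ 0 := by rintro rfl; exact hfQ Q.ring.zero_mem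
    have hinv : f⁻¹ ∈ Q.ring := (Q.ring.mem_or_inv_mem f).resolve_left hfQ
    have hu : IsUnit (⟨f⁻¹, hinv⟩ : Q.ring) := by
      apply hloc.map_nonunit
      refine IsUnit.of_mul_eq_one ⟨algebraMap F E f, hf⟩ (Subtype.ext ?_)
      change algebraMap F E f⁻¹ * algebraMap F E f = 1
      rw [← map_mul, inv_mul_cancel₀ hf0, map_one]
    obtain ⟨c, hc⟩ := hu.exists_right_inv
    have hc' : f⁻¹ * (c : F) = 1 := congrArg Subtype.val hc
    apply hfQ
    have : f = c := by
      field_simp at hc'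
      exact hc'.symm
    rw [this]
    exact c.2
  refine ⟨⟨A, fun a => ?_, fun htop => Q.ne_top ?_⟩, hA⟩
  · rw [IsScalarTower.algebraMap_apply k F E]
    exact h ⟨_, Q.algebraMap_mem a⟩
  · rw [← hA, htop]
    ext; simp

end Extension

end FFPlace

/-! ### The polynomial `L` of a subspace. -/

section SubspacePoly

variable {p : ℕ} [Fact p.Prime] {k : Type*} [Field k] [Algebra (ZMod p) k]
  (W : Submodule (ZMod p) k)

theorem subspacePoly_eq_prod [Fintype W] : subspacePoly W = ∏ w : W, (X - C (w : k)) :=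
  finprod_eq_prod_of_fintype _

theorem subspacePoly_monic [Finite W] : (subspacePoly W).Monic := by
  have := Fintype.ofFinite W
  rw [subspacePoly_eq_prod]
  exact monic_prod_X_sub_C _ _

theorem natDegree_subspacePoly [Finite W] : (subspacePoly W).natDegree = Nat.card W := by
  have := Fintype.ofFinite W
  rw [subspacePoly_eq_prod, natDegree_finsetProd_X_sub_C_eq_card, Finset.card_univ,
    Nat.card_eq_fintype_card]

theorem subspacePoly_comp [Finite W] (w : W) :
    (subspacePoly W).comp (X + C (w : k)) = subspacePoly W := by
  have := Fintype.ofFinite W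
  rw [subspacePoly_eq_prod, prod_comp]
  refine Fintype.prod_equiv (Equiv.subRight w) _ _ fun v => ?_
  simp
  ring

theorem aeval_add_subspacePoly [Finite W] {A : Type*} [CommRing A] [Algebra k A] (a : A) (w : W) :
    aeval (a + algebraMap k A w) (subspacePoly W) = aeval a (subspacePoly W) := by
  conv_rhs => rw [← subspacePoly_comp W w]
  simp [aeval_comp]

/-- Both sides are monic of degree `|W|`, so their difference has smaller degree, yet they agree at
the `|W|` points `a + w`. Only translation invariance of `L` is needed, not its additivity. -/
theorem map_subspacePoly_sub [Fintype W] {A : Type*} [Field A] [Algebra k A] (a : A) :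
    (subspacePoly W).map (algebraMap k A) - C (aeval a (subspacePoly W)) =
      ∏ w : W, (X - C (a + algebraMap k A w)) := by
  have hinj : Function.Injective fun w : W => a + algebraMap k A (w : k) := fun w w' h =>
    Subtype.ext ((algebraMap k A).injective (add_left_cancel h))
  have hN := natDegree_subspacePoly W
  rw [Nat.card_eq_fintype_card] at hN
  have hpos : 0 < Fintype.card W := Fintype.card_pos
  have hm : ((subspacePoly W).map (algebraMap k A)).Monic := (subspacePoly_monic W).map _
  have hd : ((subspacePoly W).map (algebraMap k A)).natDegree = Fintype.card W := by
    rw [natDegree_map, hN]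
  have hlt : (C (aeval a (subspacePoly W))).degree <
      ((subspacePoly W).map (algebraMap k A)).degree := by
    refine degree_C_le.trans_lt ?_
    rw [degree_eq_natDegree hm.ne_zero, hd]
    exact_mod_cast hpos
  refine eq_of_degree_sub_lt_of_eval_finset_eq
    (Finset.univ.map ⟨fun w : W => a + algebraMap k A (w : k), hinj⟩) ?_ ?_
  · rw [Finset.card_map, Finset.card_univ]
    have h1 : ((subspacePoly W).map (algebraMap k A) - C (aeval a (subspacePoly W))).degree =
        Fintype.card W := by
      rw [degree_sub_eq_left_of_degree_lt hlt, degree_eq_natDegree hm.ne_zero, hd]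
    rw [← h1]
    refine degree_sub_lt_left ?_ ?_ ?_
    · simp only [h1, degree_prod, degree_X_sub_C, Finset.sum_const, Finset.card_univ, nsmul_eq_mul,
        mul_one]
    · exact (hm.sub_of_left hlt).ne_zero
    · rw [(hm.sub_of_left hlt).leadingCoeff, (monic_prod_X_sub_C _ _).leadingCoeff]
  · intro x hx
    simp only [Finset.mem_map, Finset.mem_univ, true_and, Function.Embedding.coeFn_mk] at hx
    obtain ⟨w, rfl⟩ := hx
    have h2 : eval (a + algebraMap k A w) (∏ w : W, (X - C (a + algebraMap k A (w : k)))) = 0 := by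
      rw [eval_prod]
      exact Finset.prod_eq_zero (Finset.mem_univ w) (by simp)
    rw [h2, eval_sub, eval_map_algebraMap, aeval_add_subspacePoly, eval_C, sub_self]

theorem exists_eq_add_of_aeval_subspacePoly_eq [Finite W] {A : Type*} [Field A] [Algebra k A]
    {a b : A} (h : aeval b (subspacePoly W) = aeval a (subspacePoly W)) :
    ∃ w : W, b = a + algebraMap k A w := by
  have := Fintype.ofFinite W
  have h1 := congrArg (eval b) (map_subspacePoly_sub W a)
  rw [eval_sub, eval_map_algebraMap, eval_C, h, sub_self, eval_prod, eq_comm,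
    Finset.prod_eq_zero_iff] at h1
  obtain ⟨w, -, hw⟩ := h1
  exact ⟨w, by simpa [sub_eq_zero] using hw⟩

/-- `L'` inherits invariance under `W`, so it takes one value on `|W|` points while having degree
below `|W|`: it is constant. It is nonzero because `L` has distinct roots. -/
theorem derivative_subspacePoly [Finite W] :
    ∃ c : k, c ≠ 0 ∧ derivative (subspacePoly W) = C c := by
  have := Fintype.ofFinite W
  have hN := natDegree_subspacePoly W
  rw [Nat.card_eq_fintype_card] at hN
  have hpos : 0 < Fintype.card W := Fintype.card_pos
  have hsep : (subspacePoly W).Separable := by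
    rw [subspacePoly_eq_prod]
    exact separable_prod_X_sub_C_iff.2 Subtype.val_injective
  have hne : derivative (subspacePoly W) ≠ 0 := by
    intro h0
    rw [Separable, h0, isCoprime_zero_right, (subspacePoly_monic W).isUnit_iff] at hsep
    rw [hsep, natDegree_one] at hN
    omega
  have hcomp : ∀ w : W, (derivative (subspacePoly W)).eval (w : k) =
      (derivative (subspacePoly W)).eval 0 := by
    intro w
    have := congrArg (fun q => eval 0 (derivative q)) (subspacePoly_comp W w)
    simpa [derivative_comp] using this
  have hC : derivative (subspacePoly W) = C ((derivative (subspacePoly W)).eval 0) := by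
    refine eq_of_degree_sub_lt_of_eval_finset_eq
      (Finset.univ.map ⟨_, Subtype.val_injective (p := fun x => x ∈ W)⟩) ?_ ?_
    · refine (degree_sub_le _ _).trans_lt (max_lt ?_ ?_)
      · rw [Finset.card_map, Finset.card_univ, ← hN,
          ← degree_eq_natDegree (subspacePoly_monic W).ne_zero]
        exact degree_derivative_lt (subspacePoly_monic W).ne_zero
      · refine degree_C_le.trans_lt ?_
        rw [Finset.card_map, Finset.card_univ]
        exact_mod_cast hpos
    · intro x hx
      simp only [Finset.mem_map, Finset.mem_univ, true_and, Function.Embedding.coeFn_mk] at hx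
      obtain ⟨w, rfl⟩ := hx
      rw [hcomp, eval_C]
  refine ⟨_, fun h0 => hne ?_, hC⟩
  rw [hC, h0, C_0]

end SubspacePoly

namespace FFPlace

/-! ### The infinite place of the rational function field. -/

section Infinity

variable {k : Type*} [Field k]

theorem one_lt_valuation_iff {K : Type*} [Field K] [Algebra k K] (P : FFPlace k K) (f : K) :
    1 < P.ring.valuation f ↔ P.IsPole f := by
  rw [← not_le, ValuationSubring.valuation_le_one_iff, IsPole]

open Classical in
variable (k) in
/-- The place at infinity of the rational function field. -/
def atInfinity : FFPlace k (RatFunc k) where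
  ring := (RatFunc.inftyValuation k).valuationSubring
  algebraMap_mem a := by
    rw [Valuation.mem_valuationSubring_iff]
    exact Valuation.IsTrivialOn.valuation_algebraMap_le_one _ a
  ne_top h := by
    have hX : (RatFunc.X : RatFunc k) ∈ (RatFunc.inftyValuation k).valuationSubring := by
      rw [h]; trivial
    rw [Valuation.mem_valuationSubring_iff, RatFunc.inftyValuation.X, ← WithZero.exp_zero,
      WithZero.exp_le_exp] at hX
    omega

/-- A valuation trivial on `k` with value above 1 at `x` is equivalent to the degree valuation, and
equivalent valuations have the same ring. -/
theorem isPole_X_iff (Q : FFPlace k (RatFunc k)) : Q.IsPole RatFunc.X ↔ Q = atInfinity k := by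
  classical
  constructor
  · intro h
    have := Q.valuation_isTrivialOn
    have h1 := RatFunc.valuation_isEquiv_inftyValuation_of_one_lt_valuation_X
      ((Q.one_lt_valuation_iff _).2 h)
    have h2 := (Valuation.isEquiv_iff_valuationSubring _ _).1 h1
    rw [ValuationSubring.valuationSubring_valuation] at h2
    ext1
    rw [h2, atInfinity]
  · rintro rfl
    unfold IsPole atInfinity
    rw [Valuation.mem_valuationSubring_iff, RatFunc.inftyValuation.X, ← WithZero.exp_zero,
      WithZero.exp_le_exp]
    omega

theorem ord_atInfinity {f : RatFunc k} (hf : f ≠ 0) :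
    (atInfinity k).ord f = ((-f.intDegree : ℤ) : WithTop ℤ) := by
  have := (atInfinity k).valuation_isTrivialOn
  have hX : 1 < (atInfinity k).ring.valuation RatFunc.X :=
    (one_lt_valuation_iff _ _).2 ((isPole_X_iff _).2 rfl)
  have key : ∀ {f : RatFunc k}, f ≠ 0 → (atInfinity k).ring.valuation f =
      (atInfinity k).ring.valuation RatFunc.X ^ f.intDegree := fun hf =>
    RatFunc.valuation_eq_valuation_X_zpow_intDegree_of_one_lt_valuation_X hX hf
  have hXinv : (atInfinity k).ring.valuation (RatFunc.X⁻¹) < 1 := by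
    rw [map_inv₀]; exact inv_lt_one_of_one_lt₀ hX
  have ht : (atInfinity k).IsPrimeElement
      ⟨RatFunc.X⁻¹, ((atInfinity k).ring.valuation_le_one_iff _).1 hXinv.le⟩ := by
    rw [isPrimeElement_iff]
    intro z
    refine ⟨fun hz => ?_, fun hz => hz.trans_lt hXinv⟩
    rcases eq_or_ne z 0 with rfl | hz0
    · simp
    · rw [key hz0] at hz
      rw [key hz0, map_inv₀, ← zpow_neg_one]
      rw [← zpow_zero ((atInfinity k).ring.valuation RatFunc.X), zpow_lt_zpow_iff_right₀ hX] at hz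
      exact zpow_le_zpow_right₀ hX.le (by omega)
  refine ord_eq_of_valuation_eq ht ?_
  simp only
  rw [key hf, map_inv₀, inv_zpow, zpow_neg, inv_inv]

end Infinity

/-! ### Poles of `x` in `E` and total ramification. -/

section Ramified

variable {k : Type*} [Field k] {E : Type*} [Field E] [Algebra (RatFunc k) E] [Algebra k E]

theorem LiesAbove.isPole_X {P : FFPlace k E} (h : P.LiesAbove (atInfinity k)) :
    P.IsPole (algebraMap (RatFunc k) E RatFunc.X) := by
  unfold IsPole
  rw [h.algebraMap_mem_iff]
  exact (isPole_X_iff _).2 rfl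

variable (k) in
/-- The monomial `x ^ a * y ^ b`. -/
def monomialXY (y : E) (a b : ℤ) : E := algebraMap (RatFunc k) E RatFunc.X ^ a * y ^ b

/-- With Bézout coefficients `a`, `b`, the monomial `s = x ^ a * y ^ b` satisfies `v(s) ^ N = v(x)`
and `v(s) ^ d = v(y)`; its inverse will be the prime element. -/
theorem valuation_monomialXY_pow {P : FFPlace k E}
    (hX : P.IsPole (algebraMap (RatFunc k) E RatFunc.X)) {N d : ℕ} (hN : N ≠ 0) {y : E}
    (hyv : P.ring.valuation y ^ N = P.ring.valuation (algebraMap (RatFunc k) E RatFunc.X) ^ d)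
    {a b : ℤ} (hab : a * N + b * d = 1) :
    P.ring.valuation (monomialXY k y a b) ^ N =
        P.ring.valuation (algebraMap (RatFunc k) E RatFunc.X) ∧
      P.ring.valuation (monomialXY k y a b) ^ d = P.ring.valuation y := by
  have hx1 := (P.one_lt_valuation_iff _).2 hX
  unfold monomialXY
  rw [map_mul, map_zpow₀, map_zpow₀]
  generalize P.ring.valuation (algebraMap (RatFunc k) E RatFunc.X) = ξ at *
  generalize P.ring.valuation y = η at *
  have hξ : ξ ≠ 0 := (zero_lt_one.trans hx1).ne'
  have hη : η ≠ 0 := by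
    rintro rfl
    rw [zero_pow hN] at hyv
    exact pow_ne_zero d hξ hyv.symm
  have hyv' : η ^ (N : ℤ) = ξ ^ (d : ℤ) := by exact_mod_cast hyv
  constructor
  · rw [← zpow_natCast, mul_zpow, ← zpow_mul, ← zpow_mul, mul_comm b, zpow_mul η, hyv', ← zpow_mul,
      ← zpow_add₀ hξ, mul_comm (d : ℤ), hab, zpow_one]
  · rw [← zpow_natCast, mul_zpow, ← zpow_mul, ← zpow_mul, mul_comm a, zpow_mul ξ, ← hyv',
      ← zpow_mul, ← zpow_add₀ hη, mul_comm (N : ℤ), hab, zpow_one]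

theorem one_lt_valuation_monomialXY {P : FFPlace k E}
    (hX : P.IsPole (algebraMap (RatFunc k) E RatFunc.X)) {N d : ℕ} (hN : N ≠ 0) {y : E}
    (hyv : P.ring.valuation y ^ N = P.ring.valuation (algebraMap (RatFunc k) E RatFunc.X) ^ d)
    {a b : ℤ} (hab : a * N + b * d = 1) : 1 < P.ring.valuation (monomialXY k y a b) := by
  have hx1 := (P.one_lt_valuation_iff _).2 hX
  rw [← (valuation_monomialXY_pow hX hN hyv hab).1] at hx1
  exact (one_lt_pow_iff_of_nonneg zero_le hN).1 hx1

variable [IsScalarTower k (RatFunc k) E]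

theorem valuation_algebraMap_eq_zpow (P : FFPlace k E)
    (hX : P.IsPole (algebraMap (RatFunc k) E RatFunc.X)) {f : RatFunc k} (hf : f ≠ 0) :
    P.ring.valuation (algebraMap (RatFunc k) E f) =
      P.ring.valuation (algebraMap (RatFunc k) E RatFunc.X) ^ f.intDegree := by
  have : (P.ring.valuation.comap (algebraMap (RatFunc k) E)).IsTrivialOn k := by
    have := P.valuation_isTrivialOn
    refine ⟨fun a ha => ?_⟩
    rw [Valuation.comap_apply, ← IsScalarTower.algebraMap_apply]
    exact Valuation.IsTrivialOn.eq_one a ha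
  exact RatFunc.valuation_eq_valuation_X_zpow_intDegree_of_one_lt_valuation_X
    (v := P.ring.valuation.comap (algebraMap (RatFunc k) E)) ((P.one_lt_valuation_iff _).2 hX) hf

/-- The values of the terms of a polynomial expression in `y` of degree less than `N` are distinct,
so that one of the terms dominates. -/
theorem exists_valuation_sum_eq {P : FFPlace k E}
    (hX : P.IsPole (algebraMap (RatFunc k) E RatFunc.X)) {N d : ℕ} (hN : N ≠ 0) {y : E}
    (hyv : P.ring.valuation y ^ N = P.ring.valuation (algebraMap (RatFunc k) E RatFunc.X) ^ d)
    {a b : ℤ} (hab : a * N + b * d = 1) {c : Fin N → RatFunc k} (hc : c ≠ 0) :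
    ∃ j, c j ≠ 0 ∧
      (∀ i, c i ≠ 0 → N * (c i).intDegree + d * i ≤ N * (c j).intDegree + d * j) ∧
      P.ring.valuation (∑ i, algebraMap (RatFunc k) E (c i) * y ^ (i : ℕ)) =
        P.ring.valuation (monomialXY k y a b) ^ (N * (c j).intDegree + d * j) := by
  classical
  have hs1 := one_lt_valuation_monomialXY hX hN hyv hab
  obtain ⟨hsx, hsy⟩ := valuation_monomialXY_pow hX hN hyv hab
  obtain ⟨i₀, hi₀⟩ := Function.ne_iff.1 hc
  obtain ⟨j, hj, hmax⟩ := Finset.exists_max_image (Finset.univ.filter fun i => c i ≠ 0)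
    (fun i => N * (c i).intDegree + d * i) ⟨i₀, by simpa using hi₀⟩
  have hcj : c j ≠ 0 := by simpa using hj
  have hterm : ∀ i, c i ≠ 0 →
      P.ring.valuation (algebraMap (RatFunc k) E (c i) * y ^ (i : ℕ)) =
        P.ring.valuation (monomialXY k y a b) ^ (N * (c i).intDegree + d * i) := by
    intro i hi
    rw [map_mul, map_pow, valuation_algebraMap_eq_zpow P hX hi, ← hsx, ← hsy,
      zpow_add₀ (zero_lt_one.trans hs1).ne', zpow_mul, zpow_mul]
    simp only [zpow_natCast]
  refine ⟨j, hcj, fun i hi => hmax i (by simpa using hi), ?_⟩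
  rw [← hterm j hcj]
  refine Valuation.map_sum_eq_of_lt _ (Finset.mem_univ j) fun i hi => ?_
  have hij : i ≠ j := by simpa using hi
  rw [hterm j hcj]
  by_cases hci : c i = 0
  · rw [hci, map_zero, zero_mul, map_zero]
    exact zpow_pos (zero_lt_one.trans hs1) _
  · rw [hterm i hci]
    refine zpow_lt_zpow_right₀ hs1 (lt_of_le_of_ne (hmax i (by simpa using hci)) fun h => hij ?_)
    -- Equal values of the terms `i` and `j` would give `N ∣ d (i - j)`, hence `N ∣ i - j`,
    -- impossible for distinct indices below `N`.
    have hcop : IsCoprime (N : ℤ) (d : ℤ) := ⟨a, b, hab⟩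
    have hdvd : (N : ℤ) ∣ (d : ℤ) * ((i : ℤ) - j) :=
      ⟨(c j).intDegree - (c i).intDegree, by linarith⟩
    have h2 := hcop.dvd_of_dvd_mul_left hdvd
    have h3 := Int.eq_zero_of_abs_lt_dvd h2 (by rw [abs_lt]; omega)
    exact Fin.ext (by omega)

theorem linearIndependent_pow {P : FFPlace k E}
    (hX : P.IsPole (algebraMap (RatFunc k) E RatFunc.X)) {N d : ℕ} (hN : N ≠ 0) {y : E}
    (hyv : P.ring.valuation y ^ N = P.ring.valuation (algebraMap (RatFunc k) E RatFunc.X) ^ d)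
    {a b : ℤ} (hab : a * N + b * d = 1) :
    LinearIndependent (RatFunc k) (fun i : Fin N => y ^ (i : ℕ)) := by
  rw [Fintype.linearIndependent_iff]
  intro c hc
  by_contra! hne
  obtain ⟨j, -, -, hv⟩ := exists_valuation_sum_eq hX hN hyv hab (c := c)
    (by obtain ⟨i, hi⟩ := hne; exact fun h => hi (congrFun h i))
  simp only [Algebra.smul_def] at hc
  rw [hc, map_zero] at hv
  exact (zpow_pos (zero_lt_one.trans (one_lt_valuation_monomialXY hX hN hyv hab)) _).ne hv

/-- The criterion on the right does not involve `P`; this is what makes the place above infinity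
unique once the powers of `y` span. -/
theorem sum_pow_mem_ring_iff {P : FFPlace k E}
    (hX : P.IsPole (algebraMap (RatFunc k) E RatFunc.X)) {N d : ℕ} (hN : N ≠ 0) {y : E}
    (hyv : P.ring.valuation y ^ N = P.ring.valuation (algebraMap (RatFunc k) E RatFunc.X) ^ d)
    {a b : ℤ} (hab : a * N + b * d = 1) (c : Fin N → RatFunc k) :
    ∑ i, algebraMap (RatFunc k) E (c i) * y ^ (i : ℕ) ∈ P.ring ↔
      ∀ i, c i ≠ 0 → N * (c i).intDegree + d * i ≤ 0 := by
  rcases eq_or_ne c 0 with rfl | hc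
  · simp
  obtain ⟨j, hj, hmax, hv⟩ := exists_valuation_sum_eq hX hN hyv hab hc
  have hs1 := one_lt_valuation_monomialXY hX hN hyv hab
  rw [← ValuationSubring.valuation_le_one_iff, hv,
    ← zpow_zero (P.ring.valuation (monomialXY k y a b)), zpow_le_zpow_iff_right₀ hs1]
  exact ⟨fun h i hi => (hmax i hi).trans h, fun h => h j hj⟩

theorem isPrimeElement_inv_monomialXY {P : FFPlace k E}
    (hX : P.IsPole (algebraMap (RatFunc k) E RatFunc.X)) {N d : ℕ} (hN : N ≠ 0) {y : E}
    (hyv : P.ring.valuation y ^ N = P.ring.valuation (algebraMap (RatFunc k) E RatFunc.X) ^ d)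
    {a b : ℤ} (hab : a * N + b * d = 1)
    (hspan : ∀ z : E, ∃ c : Fin N → RatFunc k,
      z = ∑ i, algebraMap (RatFunc k) E (c i) * y ^ (i : ℕ)) :
    ∃ t : P.ring, (t : E) = (monomialXY k y a b)⁻¹ ∧ P.IsPrimeElement t := by
  have hs1 := one_lt_valuation_monomialXY hX hN hyv hab
  have hinv : P.ring.valuation (monomialXY k y a b)⁻¹ < 1 := by
    rw [map_inv₀]; exact inv_lt_one_of_one_lt₀ hs1
  refine ⟨⟨_, (P.ring.valuation_le_one_iff _).1 hinv.le⟩, rfl, ?_⟩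
  rw [isPrimeElement_iff]
  intro z
  refine ⟨fun hz => ?_, fun hz => hz.trans_lt hinv⟩
  obtain ⟨c, rfl⟩ := hspan z
  rcases eq_or_ne c 0 with rfl | hc
  · simp
  obtain ⟨j, -, -, hv⟩ := exists_valuation_sum_eq hX hN hyv hab hc
  rw [hv, ← zpow_zero (P.ring.valuation (monomialXY k y a b)), zpow_lt_zpow_iff_right₀ hs1] at hz
  rw [hv, map_inv₀, ← zpow_neg_one]
  exact zpow_le_zpow_right₀ hs1.le (by omega)

/-- A pole of `x` at which the values of `x` and `y` are related by `ν(y) N = ν(x) d`, with `N` and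
`d` coprime and `1, y, …, y ^ (N - 1)` spanning, is totally ramified. -/
theorem ord_of_valuation_pow_eq {P : FFPlace k E}
    (hX : P.IsPole (algebraMap (RatFunc k) E RatFunc.X)) {N d : ℕ} (hN : N ≠ 0) {y : E}
    (hyv : P.ring.valuation y ^ N = P.ring.valuation (algebraMap (RatFunc k) E RatFunc.X) ^ d)
    {a b : ℤ} (hab : a * N + b * d = 1)
    (hspan : ∀ z : E, ∃ c : Fin N → RatFunc k,
      z = ∑ i, algebraMap (RatFunc k) E (c i) * y ^ (i : ℕ)) :
    P.ord y = ((-(d : ℤ) : ℤ) : WithTop ℤ) ∧ ∀ f : RatFunc k, f ≠ 0 →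
      P.ord (algebraMap (RatFunc k) E f) = ((-(N * f.intDegree) : ℤ) : WithTop ℤ) := by
  obtain ⟨t, hts, ht⟩ := isPrimeElement_inv_monomialXY hX hN hyv hab hspan
  obtain ⟨hsx, hsy⟩ := valuation_monomialXY_pow hX hN hyv hab
  constructor
  · refine ord_eq_of_valuation_eq ht ?_
    rw [hts, map_inv₀, inv_zpow, zpow_neg, inv_inv, zpow_natCast, hsy]
  · intro f hf
    refine ord_eq_of_valuation_eq ht ?_
    rw [hts, map_inv₀, inv_zpow, zpow_neg, inv_inv, zpow_mul, zpow_natCast, hsx,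
      valuation_algebraMap_eq_zpow P hX hf]

end Ramified

end FFPlace

namespace FFPlace

/-! ### Valuation rings and the integral closure. -/

section Extension

variable {k F E : Type*} [Field k] [Field F] [Field E] [Algebra k F] [Algebra k E] [Algebra F E]

theorem valuation_lt_one_iff_inv_notMem {K : Type*} [Field K] (A : ValuationSubring K) (z : K) :
    A.valuation z < 1 ↔ z = 0 ∨ z⁻¹ ∉ A := by
  rcases eq_or_ne z 0 with rfl | hz
  · simp
  · rw [← ValuationSubring.valuation_le_one_iff, map_inv₀,
      inv_le_one₀ (zero_lt_iff.2 (by simpa using hz)), not_le]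
    simp [hz]

/-- An element lying in all valuation rings that contain a subring is integral over it. -/
theorem isIntegral_of_forall_mem_valuationSubring {R : Type*} [CommRing R] [Algebra R E] {b : E}
    (h : ∀ V : ValuationSubring E, (∀ a : R, algebraMap R E a ∈ V) → b ∈ V) :
    IsIntegral R b := by
  by_contra hb
  have hic : IsIntegrallyClosedIn (integralClosure R E).toSubring E :=
    inferInstanceAs (IsIntegrallyClosedIn (integralClosure R E) E)
  obtain ⟨V, hV, hbV⟩ := Subring.exists_le_valuationSubring_of_isIntegrallyClosedIn
    (R := (integralClosure R E).toSubring) (x := b) hb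
  exact hbV (h V fun a => hV ((integralClosure R E).algebraMap_mem a))

/-- Divide the minimal polynomial by a coefficient of maximal value. The result need not be monic.
-/
theorem exists_primitive_aeval_eq_zero [Algebra.IsAlgebraic F E] (A : ValuationSubring F) (z : E) :
    ∃ f : F[X], (∀ i, f.coeff i ∈ A) ∧ (∃ m, f.coeff m = 1) ∧ aeval z f = 0 := by
  have hint : IsIntegral F z := Algebra.IsIntegral.isIntegral z
  have hne := minpoly.ne_zero hint
  obtain ⟨m, hm, hmax⟩ := Finset.exists_max_image (minpoly F z).support
    (fun i => A.valuation ((minpoly F z).coeff i)) (by simpa using hne)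
  have hm0 : (minpoly F z).coeff m ≠ 0 := by simpa using hm
  refine ⟨C ((minpoly F z).coeff m)⁻¹ * minpoly F z, fun i => ?_, ⟨m, ?_⟩, by simp⟩
  · rw [coeff_C_mul, ← ValuationSubring.valuation_le_one_iff, map_mul, map_inv₀]
    by_cases hi : i ∈ (minpoly F z).support
    · refine inv_mul_le_one_of_le₀ (hmax i hi) zero_le
    · rw [notMem_support_iff.1 hi]
      simp
  · rw [coeff_C_mul, inv_mul_cancel₀ hm0]

/-- A valuation ring above `Q` in an algebraic extension is determined by the trace of its maximal
ideal on the integral closure. -/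
theorem ring_le_of_isIntegral [Algebra.IsAlgebraic F E] {Q : FFPlace k F}
    {P P' : FFPlace k E} (hP' : P'.LiesAbove Q)
    (h : ∀ b : E, IsIntegral Q.ring b →
      (P.ring.valuation b < 1 ↔ P'.ring.valuation b < 1)) : P.ring ≤ P'.ring := by
  intro z hz
  by_contra hz'
  obtain ⟨f, hfQ, ⟨m, hm⟩, hfz⟩ := exists_primitive_aeval_eq_zero Q.ring z
  have hcoeff : ∀ j i, (divX^[j] f).coeff i = f.coeff (i + j) := by
    intro j
    induction j with
    | zero => simp
    | succ j ih =>
      intro i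
      rw [Function.iterate_succ_apply', coeff_divX, ih]
      congr 1
      ring
  -- The Horner tails `b_j = f_j + f_{j+1} z + ⋯` of the relation `f(z) = 0`. Both `b_j` and
  -- `b_{j+1} z` turn out to be integral over `O_Q`, even though `z` need not be.
  set b : ℕ → E := fun j => aeval z (divX^[j] f) with hb
  have hb0 : b 0 = 0 := hfz
  have hbs : ∀ j, b j = b (j + 1) * z + algebraMap F E (f.coeff j) := by
    intro j
    have h1 := congrArg (aeval z) (divX_mul_X_add (divX^[j] f))
    simp only [map_add, map_mul, aeval_X, aeval_C, hcoeff, zero_add] at h1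
    rw [hb]
    simp only [Function.iterate_succ_apply']
    exact h1.symm
  have hmem : ∀ (V : ValuationSubring E), (∀ a : Q.ring, algebraMap Q.ring E a ∈ V) →
      ∀ j, b j ∈ V := by
    intro V hV
    have hV' : ∀ i, algebraMap F E (f.coeff i) ∈ V := fun i => hV ⟨_, hfQ i⟩
    -- If `z ∈ V`, `b_j` is a polynomial in `z`; if `z⁻¹ ∈ V`, climb from `b_0 = 0` by solving the
    -- Horner recursion for `b_{j+1}`.
    rcases V.mem_or_inv_mem z with hzV | hzV
    · intro j
      simp only [hb, aeval_eq_sum_range, Algebra.smul_def, hcoeff]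
      exact sum_mem fun i _ => mul_mem (hV' _) (pow_mem hzV i)
    · intro j
      induction j with
      | zero => rw [hb0]; exact V.zero_mem
      | succ j ih =>
        have hz0 : z ≠ 0 := by rintro rfl; exact hz' P'.ring.zero_mem
        have : b (j + 1) = (b j - algebraMap F E (f.coeff j)) * z⁻¹ := by
          rw [hbs j]; field_simp; ring
        rw [this]
        exact mul_mem (sub_mem ih (hV' j)) hzV
  have hmem' : ∀ (V : ValuationSubring E), (∀ a : Q.ring, algebraMap Q.ring E a ∈ V) →
      ∀ j, b (j + 1) * z ∈ V := by
    intro V hV j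
    rw [eq_sub_of_add_eq (hbs j).symm]
    exact sub_mem (hmem V hV j) (hV ⟨_, hfQ j⟩)
  have hint := fun j => isIntegral_of_forall_mem_valuationSubring fun V hV => hmem V hV j
  have hint' := fun j => isIntegral_of_forall_mem_valuationSubring fun V hV => hmem' V hV j
  have hQP' : ∀ a : Q.ring, algebraMap Q.ring E a ∈ P'.ring := fun a =>
    (hP'.algebraMap_mem_iff _).2 a.2
  have hz1 : P.ring.valuation z ≤ 1 := (P.ring.valuation_le_one_iff z).2 hz
  have hz1' : 1 < P'.ring.valuation z := (P'.one_lt_valuation_iff z).2 hz'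
  -- At `P'`, `z` has a pole while `b_{j+1} z` is regular, so `b_{j+1}` vanishes; integrality
  -- carries this over to `P`.
  have hsmall : ∀ j, P.ring.valuation (b (j + 1)) < 1 := by
    intro j
    rw [h _ (hint _)]
    by_contra! hge
    have h1 := (P'.ring.valuation_le_one_iff _).2 (hmem' _ hQP' j)
    rw [map_mul] at h1
    exact absurd h1 (one_lt_mul_of_le_of_lt hge hz1').not_ge
  have hsmall0 : ∀ j, P.ring.valuation (b j) < 1 := by
    rintro (_ | j)
    · rw [hb0, map_zero]; exact zero_lt_one
    · exact hsmall j
  -- Since `z` is regular at `P`, `f_m = b_m - b_{m+1} z` vanishes at `P`, contradicting `f_m = 1`.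
  have hlt : P.ring.valuation (algebraMap F E (f.coeff m)) < 1 := by
    rw [eq_sub_of_add_eq' (hbs m).symm]
    refine (Valuation.map_sub _ _ _).trans_lt (max_lt (hsmall0 m) ?_)
    rw [map_mul]
    exact mul_lt_one_of_lt_of_le (hsmall m) hz1
  rw [hm, map_one, map_one] at hlt
  exact lt_irrefl _ hlt

theorem HasValue.valuation_sub_lt_one {P : FFPlace k F} {f : F} {c : k} (h : P.HasValue f c) :
    P.ring.valuation (f - algebraMap k F c) < 1 := by
  obtain ⟨hf, hres⟩ := h
  have h1 : IsLocalRing.residue P.ring (⟨f, hf⟩ - algebraMap k P.ring c) = 0 := by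
    rw [map_sub, hres, sub_eq_zero]
    rfl
  rw [IsLocalRing.residue_eq_zero_iff, ValuationSubring.valuation_lt_one_iff] at h1
  exact h1

end Extension

end FFPlace

/-! ### Galois theory and the discriminant of `F(y)/F`. -/

section Tower

variable {p : ℕ} [Fact p.Prime] {k : Type*} [Field k] [Algebra (ZMod p) k]
  (W : Submodule (ZMod p) k) [Finite W] {E : Type*} [Field E] [Algebra k E] {y : E}

section Ring

variable {R : Type*} [CommRing R] [Nontrivial R] [Algebra k R]

omit [Finite W] [Nontrivial R] in
theorem aeval_map_subspacePoly_sub_C [Algebra R E] [IsScalarTower k R E] {U : R}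
    (hy : aeval y (subspacePoly W) = algebraMap R E U) :
    aeval y ((subspacePoly W).map (algebraMap k R) - C U) = 0 := by
  rw [map_sub, aeval_map_algebraMap, aeval_C, hy, sub_self]

theorem degree_C_lt_degree_map_subspacePoly (U : R) :
    (C U).degree < ((subspacePoly W).map (algebraMap k R)).degree := by
  refine degree_C_le.trans_lt ?_
  rw [degree_eq_natDegree ((subspacePoly_monic W).map _).ne_zero,
    (subspacePoly_monic W).natDegree_map, natDegree_subspacePoly]
  exact_mod_cast Nat.card_pos

theorem map_subspacePoly_sub_C_monic (U : R) :
    ((subspacePoly W).map (algebraMap k R) - C U).Monic :=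
  ((subspacePoly_monic W).map _).sub_of_left (degree_C_lt_degree_map_subspacePoly W U)

theorem natDegree_map_subspacePoly_sub_C (U : R) :
    ((subspacePoly W).map (algebraMap k R) - C U).natDegree = Nat.card W := by
  rw [natDegree_sub_C, (subspacePoly_monic W).natDegree_map, natDegree_subspacePoly]

theorem isIntegral_of_aeval_subspacePoly_eq [Algebra R E] [IsScalarTower k R E] {U : R}
    (hy : aeval y (subspacePoly W) = algebraMap R E U) : IsIntegral R y :=
  ⟨_, map_subspacePoly_sub_C_monic W U, aeval_map_subspacePoly_sub_C W hy⟩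

theorem span_pow_eq_adjoin [Algebra R E] [IsScalarTower k R E] {U : R}
    (hy : aeval y (subspacePoly W) = algebraMap R E U) :
    Submodule.span R (Set.range fun i : Fin (Nat.card W) => y ^ (i : ℕ)) =
      Subalgebra.toSubmodule (Algebra.adjoin R {y}) := by
  classical
  rw [← Submodule.span_range_natDegree_eq_adjoin (map_subspacePoly_sub_C_monic W U)
    (aeval_map_subspacePoly_sub_C W hy), natDegree_map_subspacePoly_sub_C]
  congr 1
  ext z
  simp only [Set.mem_range, Finset.coe_image, Finset.coe_range, Set.mem_image, Set.mem_Iio]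
  exact ⟨fun ⟨i, hi⟩ => ⟨i, i.2, hi⟩, fun ⟨i, hi, h⟩ => ⟨⟨i, hi⟩, h⟩⟩

end Ring

variable {F : Type*} [Field F] [Algebra k F] [Algebra F E] [IsScalarTower k F E] {U : F}
  (hE : IntermediateField.adjoin F {y} = ⊤) (hy : aeval y (subspacePoly W) = algebraMap F E U)

include hE hy

theorem adjoin_eq_top_of_aeval_subspacePoly_eq : Algebra.adjoin F {y} = ⊤ := by
  rw [← IntermediateField.adjoin_simple_toSubalgebra_of_isAlgebraic
    (isIntegral_of_aeval_subspacePoly_eq W hy).isAlgebraic, hE, IntermediateField.top_toSubalgebra]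

theorem span_pow_eq_top :
    Submodule.span F (Set.range fun i : Fin (Nat.card W) => y ^ (i : ℕ)) = ⊤ := by
  rw [span_pow_eq_adjoin W hy, adjoin_eq_top_of_aeval_subspacePoly_eq W hE hy,
    Algebra.top_toSubmodule]

theorem exists_eq_sum_pow (z : E) : ∃ c : Fin (Nat.card W) → F,
    z = ∑ i, algebraMap F E (c i) * y ^ (i : ℕ) := by
  have hz : z ∈ Submodule.span F (Set.range fun i : Fin (Nat.card W) => y ^ (i : ℕ)) := by
    rw [span_pow_eq_top W hE hy]; trivial
  obtain ⟨c, hc⟩ := (Submodule.mem_span_range_iff_exists_fun F).1 hz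
  exact ⟨c, by simp only [← hc, Algebra.smul_def]⟩

/-- `E` is the splitting field of `L(T) - U`, whose roots are the `y + w`; it is separable because
its derivative is a nonzero constant. -/
theorem isGalois_of_aeval_subspacePoly_eq : IsGalois F E := by
  have := Fintype.ofFinite W
  have hmap : ((subspacePoly W).map (algebraMap k F) - C U).map (algebraMap F E) =
      ∏ w : W, (X - C (y + algebraMap k E w)) := by
    rw [← map_subspacePoly_sub, Polynomial.map_sub, map_map, ← IsScalarTower.algebraMap_eq, map_C,
      hy]
  have hsplit : Polynomial.IsSplittingField F E ((subspacePoly W).map (algebraMap k F) - C U) := by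
    refine ⟨?_, ?_⟩
    · rw [hmap]
      exact Splits.prod fun w _ => Splits.X_sub_C _
    · rw [eq_top_iff, ← adjoin_eq_top_of_aeval_subspacePoly_eq W hE hy]
      refine Algebra.adjoin_mono (Set.singleton_subset_iff.2 ?_)
      rw [mem_rootSet]
      exact ⟨(map_subspacePoly_sub_C_monic W U).ne_zero, aeval_map_subspacePoly_sub_C W hy⟩
  refine IsGalois.of_separable_splitting_field (p := (subspacePoly W).map (algebraMap k F) - C U) ?_
  obtain ⟨c, hc, hd⟩ := derivative_subspacePoly W
  rw [Separable, derivative_sub, derivative_C, sub_zero, derivative_map, hd, map_C]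
  exact isCoprime_one_right.of_isCoprime_of_dvd_right
    (isUnit_iff_dvd_one.1 (isUnit_C.2 (by simpa using hc)))

/-- Each `σ y` is again a root, so it is `y + w`. The `w` are constants, fixed by every
automorphism, so composition adds them. Since `y` generates, the map is injective, and counting with
`hN` makes it bijective. -/
theorem exists_galois_mulEquiv (hN : Module.finrank F E = Nat.card W) :
    ∃ φ : (E ≃ₐ[F] E) ≃* Multiplicative W,
      ∀ σ : E ≃ₐ[F] E, σ y = y + algebraMap k E ((φ σ).toAdd : k) := by
  have hgal := isGalois_of_aeval_subspacePoly_eq W hE hy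
  have hex : ∀ σ : E ≃ₐ[F] E, ∃ w : W, σ y = y + algebraMap k E w := by
    intro σ
    refine exists_eq_add_of_aeval_subspacePoly_eq W ?_
    rw [hy]
    have := aeval_algHom_apply ((σ : E →ₐ[F] E).restrictScalars k) y (subspacePoly W)
    rw [hy] at this
    simpa using this
  choose w hw using hex
  have hfix : ∀ (σ : E ≃ₐ[F] E) (a : k), σ (algebraMap k E a) = algebraMap k E a := by
    intro σ a
    rw [IsScalarTower.algebraMap_apply k F E, σ.commutes]
  let ψ : (E ≃ₐ[F] E) →* Multiplicative W := MonoidHom.mk' (fun σ => Multiplicative.ofAdd (w σ)) (by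
    intro σ τ
    rw [← ofAdd_add]
    congr 1
    have h1 : y + algebraMap k E (w (σ * τ)) = y + algebraMap k E ((w σ + w τ : W) : k) := by
      rw [← hw, AlgEquiv.mul_apply, hw, map_add, hfix, hw, Submodule.coe_add, map_add, add_assoc]
    exact Subtype.ext ((algebraMap k E).injective (add_left_cancel h1)))
  have hinj : Function.Injective ψ := by
    intro σ τ h
    have h1 : w σ = w τ := Multiplicative.ofAdd.injective h
    have h2 : (σ : E →ₐ[F] E) = τ := by
      refine AlgHom.ext_of_adjoin_eq_top (adjoin_eq_top_of_aeval_subspacePoly_eq W hE hy) ?_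
      rintro _ rfl
      simp [hw, h1]
    exact AlgEquiv.coe_toAlgHom_injective h2
  have hfin : FiniteDimensional F E := FiniteDimensional.of_finrank_pos (hN ▸ Nat.card_pos)
  have hcard : Nat.card (E ≃ₐ[F] E) = Nat.card (Multiplicative W) := by
    rw [IsGalois.card_aut_eq_finrank, hN]
    rfl
  have hbij : Function.Bijective ψ := (Nat.bijective_iff_injective_and_card ψ).2 ⟨hinj, hcard⟩
  exact ⟨MulEquiv.ofBijective ψ hbij, hw⟩

/-- The discriminant of the powers of `y` is a constant, so that they generate the integral closure
of every integrally closed ring of fractions `F` over which `y` is integral. -/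
theorem mem_adjoin_of_isIntegral (hN : Module.finrank F E = Nat.card W) {R : Type*} [CommRing R]
    [Algebra k R] [Algebra R F] [Algebra R E] [IsScalarTower R F E] [IsScalarTower k R F]
    [IsIntegrallyClosed R] [IsFractionRing R F] (hyR : IsIntegral R y) {z : E}
    (hz : IsIntegral R z) : z ∈ Algebra.adjoin R {y} := by
  have := isGalois_of_aeval_subspacePoly_eq W hE hy
  have hfin : FiniteDimensional F E := FiniteDimensional.of_finrank_pos (hN ▸ Nat.card_pos)
  let B := PowerBasis.ofAdjoinEqTop (isIntegral_of_aeval_subspacePoly_eq W hy)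
    (adjoin_eq_top_of_aeval_subspacePoly_eq W hE hy)
  have hgen : B.gen = y := PowerBasis.ofAdjoinEqTop_gen _ _
  have hmin : minpoly F y = (subspacePoly W).map (algebraMap k F) - C U := by
    refine (eq_of_monic_of_dvd_of_natDegree_le
      (minpoly.monic (isIntegral_of_aeval_subspacePoly_eq W hy))
      (map_subspacePoly_sub_C_monic W U) (minpoly.dvd _ _ (aeval_map_subspacePoly_sub_C W hy))
      ?_).symm
    rw [natDegree_map_subspacePoly_sub_C, ← hN, B.finrank, ← B.natDegree_minpoly, hgen]
  obtain ⟨c, hc, hd⟩ := derivative_subspacePoly W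
  have hdiscr : ∃ e : k, e ≠ 0 ∧ Algebra.discr F B.basis = algebraMap k F e := by
    -- Up to sign the discriminant is the norm of the derivative of the minimal polynomial at `y`,
    -- here the norm of the constant `c`.
    refine ⟨(-1) ^ (Module.finrank F E * (Module.finrank F E - 1) / 2) * c ^ Module.finrank F E,
      mul_ne_zero (pow_ne_zero _ (by simp)) (pow_ne_zero _ hc), ?_⟩
    rw [Algebra.discr_powerBasis_eq_norm, hgen, hmin, derivative_sub, derivative_C, sub_zero,
      derivative_map, hd, map_C, aeval_C, Algebra.norm_algebraMap]
    simp
  obtain ⟨e, he, hdisc⟩ := hdiscr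
  have h1 := Algebra.discr_mul_isIntegral_mem_adjoin F (B := B) (R := R) (hgen ▸ hyR) hz
  rw [hdisc, hgen] at h1
  -- The discriminant times `z` lies in `R[y]`, and the discriminant is a unit of `R` because it
  -- comes from `kˣ`.
  have h2 := Subalgebra.smul_mem _ h1 (algebraMap k R e⁻¹)
  rwa [← IsScalarTower.algebraMap_smul F (algebraMap k R e⁻¹), ← IsScalarTower.algebraMap_apply,
    smul_smul, ← map_mul, inv_mul_cancel₀ he, map_one, one_smul] at h2

end Tower

namespace FFPlace

/-! ### Complete splitting and integral bases. -/

section Splitting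

variable {k F E : Type*} [Field k] [Field F] [Field E] [Algebra k F] [Algebra k E] [Algebra F E]

instance ringScalarTowerExtension [IsScalarTower k F E] (Q : FFPlace k F) :
    IsScalarTower k Q.ring E :=
  IsScalarTower.of_algebraMap_eq fun a => IsScalarTower.algebraMap_apply k F E a

/-- The image of a place under an automorphism. -/
def comapEquiv [IsScalarTower k F E] (P : FFPlace k E) (σ : E ≃ₐ[F] E) : FFPlace k E where
  ring := P.ring.comap (σ : E →+* E)
  algebraMap_mem a := by
    rw [ValuationSubring.mem_comap, IsScalarTower.algebraMap_apply k F E]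
    change σ _ ∈ _
    rw [σ.commutes, ← IsScalarTower.algebraMap_apply]
    exact P.algebraMap_mem a
  ne_top h := by
    apply P.ne_top
    rw [eq_top_iff]
    intro z _
    have hz : σ.symm z ∈ P.ring.comap (σ : E →+* E) := by rw [h]; trivial
    rw [ValuationSubring.mem_comap] at hz
    change σ (σ.symm z) ∈ _ at hz
    rwa [σ.apply_symm_apply] at hz

theorem mem_comapEquiv_ring [IsScalarTower k F E] (P : FFPlace k E) (σ : E ≃ₐ[F] E) (z : E) :
    z ∈ (P.comapEquiv σ).ring ↔ σ z ∈ P.ring := Iff.rfl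

theorem LiesAbove.comapEquiv [IsScalarTower k F E] {P : FFPlace k E} {Q : FFPlace k F}
    (h : P.LiesAbove Q) (σ : E ≃ₐ[F] E) : (P.comapEquiv σ).LiesAbove Q := by
  unfold LiesAbove
  ext f
  rw [ValuationSubring.mem_comap, mem_comapEquiv_ring, σ.commutes, h.algebraMap_mem_iff]

theorem valuation_comapEquiv_lt_one_iff [IsScalarTower k F E] (P : FFPlace k E) (σ : E ≃ₐ[F] E)
    (z : E) : (P.comapEquiv σ).ring.valuation z < 1 ↔ P.ring.valuation (σ z) < 1 := by
  rw [valuation_lt_one_iff_inv_notMem, valuation_lt_one_iff_inv_notMem, mem_comapEquiv_ring,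
    map_inv₀, map_eq_zero_iff σ σ.injective]

/-- The difference of the two constants has value below 1, and only the constant 0 does. -/
theorem eq_of_valuation_sub_lt_one {K : Type*} [Field K] [Algebra k K] {P : FFPlace k K} {z : K}
    {a b : k} (ha : P.ring.valuation (z - algebraMap k K a) < 1)
    (hb : P.ring.valuation (z - algebraMap k K b) < 1) : a = b := by
  by_contra hne
  have htriv := P.valuation_isTrivialOn
  have h1 : P.ring.valuation (algebraMap k K (b - a)) < 1 := by
    have h2 : algebraMap k K (b - a) = (z - algebraMap k K a) - (z - algebraMap k K b) := by
      rw [map_sub]; ring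
    rw [h2]
    exact (Valuation.map_sub _ _ _).trans_lt (max_lt ha hb)
  rw [htriv.eq_one _ (sub_ne_zero.2 (Ne.symm hne))] at h1
  exact lt_irrefl _ h1

/-- The trace of the maximal ideal of `P` on `O_Q[y]` is determined by a constant value of `y`. -/
theorem valuation_lt_one_iff_of_mem_adjoin [IsScalarTower k F E] {Q : FFPlace k F}
    {P P' : FFPlace k E} (hP : P.LiesAbove Q) (hP' : P'.LiesAbove Q) {y : E} {c : k}
    (hy : P.ring.valuation (y - algebraMap k E c) < 1)
    (hy' : P'.ring.valuation (y - algebraMap k E c) < 1) {z : E}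
    (hz : z ∈ Algebra.adjoin Q.ring {y}) :
    P.ring.valuation z < 1 ↔ P'.ring.valuation z < 1 := by
  -- Substituting `c` for `y` in `z` gives `q ∈ O_Q` congruent to `z`, the same `q` for all places
  -- `T` above `Q` where `y` has residue `c`.
  have key : ∃ q : Q.ring, ∀ T : FFPlace k E, T.LiesAbove Q →
      T.ring.valuation (y - algebraMap k E c) < 1 →
      T.ring.valuation (z - algebraMap F E q) < 1 := by
    induction hz using Algebra.adjoin_induction with
    | mem x hx =>
      obtain rfl : x = y := hx
      refine ⟨algebraMap k Q.ring c, fun T _ h => ?_⟩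
      have : algebraMap F E (algebraMap k Q.ring c : Q.ring) = algebraMap k E c :=
        (IsScalarTower.algebraMap_apply k F E c).symm
      rwa [this]
    | algebraMap r =>
      refine ⟨r, fun T _ _ => ?_⟩
      have : algebraMap Q.ring E r = algebraMap F E r := rfl
      rw [this, sub_self, map_zero]
      exact zero_lt_one
    | add x x' _ _ hx hx' =>
      obtain ⟨q, hq⟩ := hx
      obtain ⟨q', hq'⟩ := hx'
      refine ⟨q + q', fun T hT h => ?_⟩
      have : x + x' - algebraMap F E ((q + q' : Q.ring) : F) =
          (x - algebraMap F E q) + (x' - algebraMap F E q') := by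
        rw [show ((q + q' : Q.ring) : F) = q + q' from rfl, map_add]; ring
      rw [this]
      exact (Valuation.map_add _ _ _).trans_lt (max_lt (hq T hT h) (hq' T hT h))
    | mul x x' _ _ hx hx' =>
      obtain ⟨q, hq⟩ := hx
      obtain ⟨q', hq'⟩ := hx'
      refine ⟨q * q', fun T hT h => ?_⟩
      have hqT : T.ring.valuation (algebraMap F E q) ≤ 1 :=
        (T.ring.valuation_le_one_iff _).2 ((hT.algebraMap_mem_iff _).2 q.2)
      have hqT' : T.ring.valuation (algebraMap F E q') ≤ 1 :=
        (T.ring.valuation_le_one_iff _).2 ((hT.algebraMap_mem_iff _).2 q'.2)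
      have hx1 : T.ring.valuation x ≤ 1 := by
        have h3 := Valuation.map_add T.ring.valuation (x - algebraMap F E q) (algebraMap F E q)
        rw [sub_add_cancel] at h3
        exact h3.trans (max_le (hq T hT h).le hqT)
      have : x * x' - algebraMap F E ((q * q' : Q.ring) : F) =
          x * (x' - algebraMap F E q') + (x - algebraMap F E q) * algebraMap F E q' := by
        rw [show ((q * q' : Q.ring) : F) = q * q' from rfl, map_mul]; ring
      rw [this]
      refine (Valuation.map_add _ _ _).trans_lt (max_lt ?_ ?_)
      · rw [map_mul]
        exact (mul_le_of_le_one_left' hx1).trans_lt (hq' T hT h)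
      · rw [map_mul]
        exact mul_lt_one_of_lt_of_le (hq T hT h) hqT'
  obtain ⟨q, hq⟩ := key
  have hT : ∀ T : FFPlace k E, T.LiesAbove Q → T.ring.valuation (y - algebraMap k E c) < 1 →
      (T.ring.valuation z < 1 ↔ Q.ring.valuation (q : F) < 1) := by
    intro T hT h
    rw [← hT.valuation_lt_one_iff]
    constructor
    · intro h1
      have h2 := Valuation.map_sub T.ring.valuation z (z - algebraMap F E q)
      rw [sub_sub_cancel] at h2
      exact h2.trans_lt (max_lt h1 (hq T hT h))
    · intro h1
      have h2 := Valuation.map_add T.ring.valuation (z - algebraMap F E q) (algebraMap F E q)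
      rw [sub_add_cancel] at h2
      exact h2.trans_lt (max_lt (hq T hT h) h1)
  rw [hT P hP hy, hT P' hP' hy']

variable {p : ℕ} [Fact p.Prime] [Algebra (ZMod p) k]
  (W : Submodule (ZMod p) k) [Finite W] {y : E} {U : F}
  [IsScalarTower k F E]

/-- The product `L(y) - L(α) = ∏ (y - α - w)` vanishes at `P`, so one of its factors does. -/
theorem exists_valuation_sub_lt_one (hy : aeval y (subspacePoly W) = algebraMap F E U)
    {Q : FFPlace k F} {P : FFPlace k E} (hP : P.LiesAbove Q) {α : k}
    (hα : Q.ring.valuation (U - algebraMap k F ((subspacePoly W).eval α)) < 1) :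
    ∃ w : W, P.ring.valuation (y - algebraMap k E (α + w)) < 1 := by
  have := Fintype.ofFinite W
  rw [← hP.valuation_lt_one_iff, map_sub, ← hy, ← IsScalarTower.algebraMap_apply,
    ← aeval_algebraMap_apply_eq_algebraMap_eval] at hα
  have h1 := congrArg (eval y) (map_subspacePoly_sub W (algebraMap k E α))
  rw [eval_sub, eval_map_algebraMap, eval_C, eval_prod] at h1
  rw [h1, map_prod] at hα
  by_contra! hge
  refine hα.not_ge (Finset.one_le_prod' fun w _ => ?_)
  simpa using hge w

theorem splitsCompletely_of_valuation_sub_lt_one (hE : IntermediateField.adjoin F {y} = ⊤)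
    (hy : aeval y (subspacePoly W) = algebraMap F E U) (hN : Module.finrank F E = Nat.card W)
    {Q : FFPlace k F} (hU : U ∈ Q.ring) {α : k}
    (hα : Q.ring.valuation (U - algebraMap k F ((subspacePoly W).eval α)) < 1) :
    Q.SplitsCompletely E := by
  have hfin : FiniteDimensional F E := FiniteDimensional.of_finrank_pos (hN ▸ Nat.card_pos)
  have hyR : IsIntegral Q.ring y :=
    isIntegral_of_aeval_subspacePoly_eq W (R := Q.ring) (U := ⟨U, hU⟩) hy
  choose g hg using fun P : {P : FFPlace k E | P.LiesAbove Q} =>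
    exists_valuation_sub_lt_one W hy P.2 hα
  -- Integral elements lie in `O_Q[y]`, where vanishing at a place depends only on the residue of
  -- `y`; this determines the valuation ring.
  have hinj : Function.Injective g := by
    intro P P' h
    have hP' := hg P'
    rw [← h] at hP'
    have key := fun b (hb : IsIntegral Q.ring b) => valuation_lt_one_iff_of_mem_adjoin P.2 P'.2
      (hg P) hP' (mem_adjoin_of_isIntegral W hE hy hN hyR hb)
    refine Subtype.ext (FFPlace.ext (le_antisymm ?_ ?_))
    · exact ring_le_of_isIntegral P'.2 key
    · exact ring_le_of_isIntegral P.2 fun b hb => (key b hb).symm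
  have hsurj : Function.Surjective g := by
    intro w
    obtain ⟨P, hP⟩ := exists_liesAbove (E := E) Q
    obtain ⟨φ, hφ⟩ := exists_galois_mulEquiv W hE hy hN
    -- Translating `y` by `w - w_P` moves the residue from `α + w_P` to `α + w` at the pulled-back
    -- place.
    obtain ⟨σ, hσ⟩ := φ.surjective (Multiplicative.ofAdd (w - g ⟨P, hP⟩))
    refine ⟨⟨P.comapEquiv σ, hP.comapEquiv σ⟩, ?_⟩
    have h1 : (P.comapEquiv σ).ring.valuation (y - algebraMap k E (α + w)) < 1 := by
      rw [valuation_comapEquiv_lt_one_iff, map_sub, hφ, hσ,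
        IsScalarTower.algebraMap_apply k F E (α + w), σ.commutes, ← IsScalarTower.algebraMap_apply k F E]
      convert hg ⟨P, hP⟩ using 2
      simp only [toAdd_ofAdd, Submodule.coe_sub, map_add, map_sub]
      ring
    have h2 := eq_of_valuation_sub_lt_one (hg ⟨P.comapEquiv σ, hP.comapEquiv σ⟩) h1
    exact Subtype.ext (add_left_cancel h2)
  have hfinite : Finite {P : FFPlace k E | P.LiesAbove Q} := Finite.of_injective g hinj
  refine ⟨Set.toFinite _, ?_⟩
  rw [hN, ← Nat.card_coe_set_eq]
  exact Nat.card_congr (Equiv.ofBijective g ⟨hinj, hsurj⟩)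

theorem isIntegralBasisAt_pow (hE : IntermediateField.adjoin F {y} = ⊤)
    (hy : aeval y (subspacePoly W) = algebraMap F E U) (hN : Module.finrank F E = Nat.card W)
    {Q : FFPlace k F} (hU : U ∈ Q.ring) :
    Q.IsIntegralBasisAt (fun i : Fin (Nat.card W) => y ^ (i : ℕ)) := by
  have hyR : IsIntegral Q.ring y :=
    isIntegral_of_aeval_subspacePoly_eq W (R := Q.ring) (U := ⟨U, hU⟩) hy
  have htop := span_pow_eq_top W hE hy
  refine ⟨linearIndependent_of_top_le_span_of_card_eq_finrank htop.ge (by simp [hN]), htop, ?_⟩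
  rw [span_pow_eq_adjoin W (R := Q.ring) (U := ⟨U, hU⟩) hy]
  congr 1
  refine le_antisymm (adjoin_le_integralClosure hyR) fun z hz => ?_
  exact mem_adjoin_of_isIntegral W hE hy hN hyR hz

end Splitting

end FFPlace

/-! ### The equation `L(y) = u(x)` over the rational function field. -/

namespace FFPlace

theorem aeval_mem_ring {k K : Type*} [Field k] [Field K] [Algebra k K] (P : FFPlace k K) {z : K}
    (hz : z ∈ P.ring) (q : k[X]) : aeval z q ∈ P.ring := by
  simp only [aeval_eq_sum_range, Algebra.smul_def]
  exact sum_mem fun i _ => mul_mem (P.algebraMap_mem _) (pow_mem hz i)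

theorem algebraMap_mem_ring {k : Type*} [Field k] {Q : FFPlace k (RatFunc k)}
    (hQ : Q ≠ atInfinity k) (u : k[X]) : algebraMap k[X] (RatFunc k) u ∈ Q.ring := by
  have hX : (RatFunc.X : RatFunc k) ∈ Q.ring := by
    by_contra h
    exact hQ ((isPole_X_iff Q).1 h)
  have h := Q.aeval_mem_ring hX u
  rwa [← RatFunc.algebraMap_X, aeval_algebraMap_apply, aeval_X_left_apply] at h

variable {p : ℕ} [Fact p.Prime] {k : Type*} [Field k] [Algebra (ZMod p) k]
  (W : Submodule (ZMod p) k) [Finite W]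
  {E : Type*} [Field E] [Algebra (RatFunc k) E] [Algebra k E] [IsScalarTower k (RatFunc k) E]

/-- Since `u` is nonconstant it has a pole where `x` has one, so `y` has a pole too (otherwise
`L(y)` would be regular), and then the leading term of `L(y)` dominates. -/
theorem valuation_pow_card_eq {u : k[X]} (hd : u.natDegree ≠ 0) {y : E}
    (hy : aeval y (subspacePoly W) =
      algebraMap (RatFunc k) E (algebraMap k[X] (RatFunc k) u)) {P : FFPlace k E}
    (hX : P.IsPole (algebraMap (RatFunc k) E RatFunc.X)) :
    P.ring.valuation y ^ Nat.card W =
      P.ring.valuation (algebraMap (RatFunc k) E RatFunc.X) ^ u.natDegree := by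
  have htriv := P.valuation_isTrivialOn
  have hx1 := (P.one_lt_valuation_iff _).2 hX
  have hu : u ≠ 0 := by rintro rfl; simp at hd
  have huv : P.ring.valuation (aeval y (subspacePoly W)) =
      P.ring.valuation (algebraMap (RatFunc k) E RatFunc.X) ^ u.natDegree := by
    rw [hy, valuation_algebraMap_eq_zpow P hX (by simpa using hu), RatFunc.intDegree_polynomial,
      zpow_natCast]
  have hy1 : 1 < P.ring.valuation y := by
    rw [one_lt_valuation_iff]
    intro hyP
    have h := (P.ring.valuation_le_one_iff _).2 (P.aeval_mem_ring hyP (subspacePoly W))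
    rw [huv] at h
    exact (one_lt_pow₀ hx1 hd).not_ge h
  rw [← huv, valuation_aeval_eq_valuation_X_pow_natDegree_of_one_lt_valuation_X y hy1
    (subspacePoly_monic W).ne_zero, natDegree_subspacePoly]

end FFPlace

end

/-! ### Assembly of the theorem. -/

theorem mainTheorem6 {p : ℕ} [Fact p.Prime] {k : Type*} [Field k] [Finite k]
    [Algebra (ZMod p) k] (W : Submodule (ZMod p) k) (r : ℕ)
    (hW : Module.finrank (ZMod p) W = r)
    (u : k[X]) (d : ℕ) (hd : u.natDegree = d) (hdp : Nat.Coprime d p)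
    {E : Type*} [Field E] [Algebra (RatFunc k) E] [Algebra k E] [IsScalarTower k (RatFunc k) E]
    (y : E) (hE : IntermediateField.adjoin (RatFunc k) {y} = ⊤)
    (hy : aeval y (subspacePoly W) =
      algebraMap (RatFunc k) E (algebraMap k[X] (RatFunc k) u)) :
    -- (i)
    (IsGalois (RatFunc k) E ∧
      Module.finrank (RatFunc k) E = p ^ r ∧
      Nonempty ((E ≃ₐ[RatFunc k] E) ≃* Multiplicative (Fin r → ZMod p)) ∧
      ∃ φ : (E ≃ₐ[RatFunc k] E) ≃* Multiplicative W,
        ∀ σ : E ≃ₐ[RatFunc k] E, σ y = y + algebraMap k E ((φ σ).toAdd : k)) ∧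
    (∃ Qinf : FFPlace k (RatFunc k),
      (∀ Q : FFPlace k (RatFunc k), Q.IsPole RatFunc.X ↔ Q = Qinf) ∧
      -- (ii)
      Qinf.TotallyRamified E ∧
      (∃ Pinf : FFPlace k E,
        (∀ P : FFPlace k E, P.LiesAbove Qinf ↔ P = Pinf) ∧
        Pinf.ord (algebraMap (RatFunc k) E RatFunc.X) = ((-(p ^ r : ℤ) : ℤ) : WithTop ℤ) ∧
        Pinf.ord y = ((-(d : ℤ) : ℤ) : WithTop ℤ)) ∧
      -- (iii)
      (∀ Q : FFPlace k (RatFunc k), Q ≠ Qinf →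
        Q.IsIntegralBasisAt (fun i : Fin (p ^ r) => y ^ (i : ℕ)))) ∧
    -- (iv)
    (∀ Q : FFPlace k (RatFunc k), Q.IsRational →
      (∃ α : k, Q.HasValue (algebraMap k[X] (RatFunc k) u) ((subspacePoly W).eval α)) →
      Q.SplitsCompletely E) := by
  have hcard : Nat.card W = p ^ r := by
    rw [Module.natCard_eq_pow_finrank (K := ZMod p), Nat.card_zmod, hW]
  have hp := (Fact.out : p.Prime)
  have hN0 : Nat.card W ≠ 0 := Nat.card_pos.ne'
  -- Degree 0 is excluded because `gcd(0, p) = p ≠ 1`.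
  have hd0 : u.natDegree ≠ 0 := by
    rw [hd]
    rintro rfl
    exact hp.one_lt.ne' (by simpa using hdp)
  obtain ⟨a, b, hab⟩ : ∃ a b : ℤ, a * (Nat.card W : ℕ) + b * d = 1 := by
    rw [hcard]
    exact Nat.isCoprime_iff_coprime.2 (hdp.symm.pow_left r)
  have hval : ∀ {P : FFPlace k E}, P.LiesAbove (FFPlace.atInfinity k) →
      P.ring.valuation y ^ Nat.card W =
        P.ring.valuation (algebraMap (RatFunc k) E RatFunc.X) ^ d := fun hP =>
    hd ▸ FFPlace.valuation_pow_card_eq W hd0 hy hP.isPole_X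
  have hspan := exists_eq_sum_pow W hE hy
  obtain ⟨Pinf, hPinf⟩ := FFPlace.exists_liesAbove (E := E) (FFPlace.atInfinity k)
  have hlin := FFPlace.linearIndependent_pow hPinf.isPole_X hN0 (hval hPinf) hab
  -- The degree comes from the place at infinity: distinct values there make the spanning powers of
  -- `y` independent, with no separate irreducibility argument.
  have hN : Module.finrank (RatFunc k) E = Nat.card W := by
    rw [Module.finrank_eq_card_basis (Module.Basis.mk hlin (span_pow_eq_top W hE hy).ge),
      Fintype.card_fin]
  have huniq : ∀ P : FFPlace k E, P.LiesAbove (FFPlace.atInfinity k) ↔ P = Pinf := by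
    refine fun P => ⟨fun hP => FFPlace.ext ?_, fun h => h ▸ hPinf⟩
    ext z
    obtain ⟨c, rfl⟩ := hspan z
    rw [FFPlace.sum_pow_mem_ring_iff hP.isPole_X hN0 (hval hP) hab,
      FFPlace.sum_pow_mem_ring_iff hPinf.isPole_X hN0 (hval hPinf) hab]
  obtain ⟨hordy, hord⟩ :=
    FFPlace.ord_of_valuation_pow_eq hPinf.isPole_X hN0 (hval hPinf) hab hspan
  refine ⟨⟨isGalois_of_aeval_subspacePoly_eq W hE hy, hN.trans hcard, ?_,
    exists_galois_mulEquiv W hE hy hN⟩, ⟨FFPlace.atInfinity k, FFPlace.isPole_X_iff,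
    ⟨Pinf, huniq, ?_⟩, ⟨Pinf, huniq, ?_, hordy⟩, ?_⟩, ?_⟩
  · obtain ⟨φ, -⟩ := exists_galois_mulEquiv W hE hy hN
    have e : W ≃ₗ[ZMod p] (Fin r → ZMod p) := LinearEquiv.ofFinrankEq _ _ (by simp [hW])
    exact ⟨φ.trans (AddEquiv.toMultiplicative e.toAddEquiv)⟩
  · intro f hf
    rw [hord f hf, FFPlace.ord_atInfinity hf, hN, ← WithTop.coe_nsmul, nsmul_eq_mul, mul_neg]
  · rw [hord _ RatFunc.X_ne_zero, RatFunc.intDegree_X, mul_one, hcard, Nat.cast_pow]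
  · intro Q hQ
    rw [← hcard]
    exact FFPlace.isIntegralBasisAt_pow W hE hy hN (FFPlace.algebraMap_mem_ring hQ u)
  · rintro Q - ⟨α, hα⟩
    exact FFPlace.splitsCompletely_of_valuation_sub_lt_one W hE hy hN hα.choose
      hα.valuation_sub_lt_one
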